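/- Let $G=(V,E)$ be an infinite, connected, locally finite, quasitransitive simple graph (i.e. its automorphism group has finitely many orbits on $V$; unimodularity of $G$ is not required). Configurations are subsets $\omega\in 2^E$, and $C_x=C_x(\omega)$ is the component of $x$ in $(V,\omega)$. Let $G_n$ be an exhaustion of $G$ by finite connected induced subgraphs, and let $\hat G_n$ be obtained from $G_n$ by adding a vertex $z_n$ and, for each edge $\{u,v\}\in E$ with $u\in V(G_n)$, $v\notin V(G_n)$, a copy of the edge $\{u,z_n\}$. The free (FUSF), respectively wired (WUSF), uniform spanning forest of $G$ is the random subset of $E$ whose law is the weak limit of the uniform distributions on the spanning trees of $G_n$, respectively $\hat G_n$. For an edge $e=\{x,y\}\in E$ with a chosen endpoint $x$, an integer $r\ge 0$, and a measurable function $f=f(\omega,e,x,r)\in E\cup\{\emptyset\}$ of the configurations $\omega$ with $C_x\ne C_y$, put $\pi_e^fA=\{(\omega\cup\{e\})\setminus \{f(\omega,e,x,r)\}:\omega\in A\}$ (nothing is deleted when $f=\emptyset$). For a random forest with law $\mathbf P$, call an event $A$ *admissible* (for $e$) if $\mathbf P(A)>0$ and $C_x\neq C_y$ for almost every $\omega\in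 A$; call $f$ *admissible* (for $e,x,r$) if almost surely on $\{C_x\neq C_y\}$, whenever $f\ne\emptyset$, $f$ is an edge of $C_x$ both of whose endpoints are at $G$-distance more than $r$ from $x$, and if $\mathbf P(\pi_e^fA)>0$ for every admissible event $A$. The random forest is *weakly insertion tolerant* if an admissible $f$ exists for all $e$, $x$, $r$. **Lemma.** The FUSF and the WUSF of $G$ are weakly insertion tolerant. Moreover, there is a function $\delta:\mathbb N\to(0,\infty)$, depending only on $G$, such that, for both forests and for all $e=\{x,y\}\in E$, $x\in e$ and $r\ge 0$, an admissible $f$ can be chosen with $$\mathbf P(\pi_e^fA)>\delta(r)\,\mathbf P(A)\qquad\text{for every admissible event }A.$$ -/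

import Mathlib

open MeasureTheory Filter Topology
open scoped NNReal

namespace USF

variable {V : Type*}

/-- A configuration `ω ∈ 2^E`: the edge `e` is present in `ω` iff `ω e = true`. Configurations carry
the product topology and the product `σ`-algebra. -/
abbrev Config (G : SimpleGraph V) : Type _ := G.edgeSet → Bool

/-- The subgraph of `G` with vertex set `V` whose edges are the edges present in `ω`. -/
def Config.graph {G : SimpleGraph V} (ω : Config G) : SimpleGraph V :=
  SimpleGraph.fromEdgeSet {e | ∃ h : e ∈ G.edgeSet, ω ⟨e, h⟩ = true}

/-- There are finitely many vertices such that every vertex can be mapped to one of them by an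
automorphism, i.e. the automorphism group has finitely many orbits on vertices. -/
def IsQuasitransitive (G : SimpleGraph V) : Prop :=
  ∃ F : Finset V, ∀ v : V, ∃ φ : G ≃g G, φ v ∈ F

/-- An exhaustion of `G` by finite connected subgraphs `G_n = G[S n]`. -/
structure IsExhaustion (G : SimpleGraph V) (S : ℕ → Finset V) : Prop where
  mono : Monotone S
  exhausts : ∀ v, ∃ n, v ∈ S n
  connected : ∀ n, (G.induce (S n : Set V)).Connected

/-- A set `T` of edges of a multigraph with vertex set `W`, edge set `E` and endpoint map `ends` is
(the edge set of) a spanning tree: it has no loops and no parallel edges, and the simple graph that it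
then forms on `W` is a tree. -/
def IsSpanningTree {W E : Type*} (ends : E → Sym2 W) (T : Set E) : Prop :=
  (∀ e ∈ T, ¬ (ends e).IsDiag) ∧ Set.InjOn ends T ∧
    (SimpleGraph.fromEdgeSet (ends '' T)).IsTree

/-- The spanning trees of the finite graph `G_n = G[S]`, as configurations on `G`. -/
def freeTrees (G : SimpleGraph V) (S : Finset V) : Set (Config G) :=
  {ω | (∀ e : G.edgeSet, ω e = true → ∀ v ∈ (e : Sym2 V), v ∈ S) ∧
    (ω.graph.induce (S : Set V)).IsTree}

open Classical in
/-- The map that keeps the vertices of `S` and sends all others to one extra vertex `z = none`. -/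
noncomputable def collapse (S : Finset V) (v : V) : Option S :=
  if h : v ∈ S then some ⟨v, h⟩ else none

/-- The spanning trees of the wired multigraph obtained from `G[S]` by adding a vertex `z` and, for each
edge of `G` from a vertex `u` of `S` to a vertex outside `S`, a copy of the edge `{u, z}`; they are
viewed as configurations on `G`. (Edges of `G` without endpoint in `S` would be loops at `z`, which a
spanning tree never contains.) -/
def wiredTrees (G : SimpleGraph V) (S : Finset V) : Set (Config G) :=
  {ω | IsSpanningTree (fun e : G.edgeSet => Sym2.map (collapse S) (e : Sym2 V))
    {e | ω e = true}}

section Forests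

variable [Countable V]

/-- `P` is the weak limit of the uniform distributions on the finite sets `trees (S n)`, along an
exhaustion `S` of `G`. -/
def IsUniformLimit (G : SimpleGraph V) (trees : Finset V → Set (Config G))
    (P : ProbabilityMeasure (Config G)) : Prop :=
  ∃ S : ℕ → Finset V, IsExhaustion G S ∧
    ∃ ν : ℕ → ProbabilityMeasure (Config G),
      (∀ n, (ν n : Measure (Config G)) = ProbabilityTheory.uniformOn (trees (S n))) ∧
      Tendsto ν atTop (𝓝 P)

/-- `P` is the law of the free uniform spanning forest of `G`. -/
def IsFUSF (G : SimpleGraph V) (P : ProbabilityMeasure (Config G)) : Prop :=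
  IsUniformLimit G (freeTrees G) P

/-- `P` is the law of the wired uniform spanning forest of `G`. -/
def IsWUSF (G : SimpleGraph V) (P : ProbabilityMeasure (Config G)) : Prop :=
  IsUniformLimit G (wiredTrees G) P

end Forests

open Classical in
/-- `ω ∪ {e} \ f`, where `f` is an edge or empty. -/
noncomputable def insDel {G : SimpleGraph V} (e : G.edgeSet) (f : Option G.edgeSet) (ω : Config G) :
    Config G :=
  fun g => if f = some g then false else if g = e then true else ω g

/-- The event `{ω ∪ {e} \ f(ω) : ω ∈ A}`. -/
def insDelEvent {G : SimpleGraph V} (e : G.edgeSet) (f : Config G → Option G.edgeSet)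
    (A : Set (Config G)) : Set (Config G) :=
  (fun ω => insDel e (f ω) ω) '' A

/-- The events considered for the edge `{x, y}`: measurable, of positive probability, and almost every
configuration in `A` has `x` and `y` in different components. -/
structure IsSeparatingEvent {G : SimpleGraph V} (P : ProbabilityMeasure (Config G)) (x y : V)
    (A : Set (Config G)) : Prop where
  measurable : MeasurableSet A
  pos : 0 < P A
  separates : ∀ᵐ ω ∂(P : Measure (Config G)), ω ∈ A → ¬ ω.graph.Reachable x y

/-- `f` is an edge selection as required by weak insertion tolerance, for the edge `{x, y}`, its
endpoint `x`, and the radius `r`. Only its values on configurations with `x`, `y` in different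
components matter. -/
structure IsSelection {G : SimpleGraph V} (P : ProbabilityMeasure (Config G)) {x y : V}
    (h : G.Adj x y) (r : ℕ) (f : Config G → Option G.edgeSet) : Prop where
  /-- `f` is measurable, the countable set of values being discrete. -/
  measurable : @Measurable (Config G) (Option G.edgeSet) _ ⊤ f
  /-- A nonempty `f(ω)` is almost surely an edge of the component of `x` in `ω`, and lies outside the
  ball `B(x, r)` of `G`. -/
  location : ∀ᵐ ω ∂(P : Measure (Config G)), ¬ ω.graph.Reachable x y →
    ∀ g : G.edgeSet, f ω = some g →
      ω g = true ∧ ∀ v ∈ (g : Sym2 V), ω.graph.Reachable x v ∧ r < G.dist x v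
  /-- Inserting `{x, y}` and deleting `f` preserves positivity of probability. -/
  positive : ∀ A : Set (Config G), IsSeparatingEvent P x y A →
    0 < P (insDelEvent ⟨s(x, y), h⟩ f A)

/-- `P` is the law of a random forest of `G` that is weakly insertion tolerant. -/
structure IsWIT {G : SimpleGraph V} (P : ProbabilityMeasure (Config G)) : Prop where
  forest : ∀ᵐ ω ∂(P : Measure (Config G)), ω.graph.IsAcyclic
  tolerant : ∀ (x y : V) (h : G.Adj x y) (r : ℕ), ∃ f, IsSelection P h r f

end USF

namespace USF

open SimpleGraph

/-! ### Edge exchange in trees -/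

section Tree

variable {W : Type*} {H : SimpleGraph W}

/-! Let `e = xy`, and suppose a spanning tree of a finite graph containing the ball `B(x, r + 2)`
does not connect `x` to `y` inside that ball. The tree path from `x` to `y` then uses an edge `g`
with endpoints at distance `r + 1` or `r + 2` from `x`, joined to `x` inside the ball. Replacing `g`
by `e` gives another spanning tree, and the old tree is recovered from the new one and `g`. Counting
trees therefore bounds the probability of an event `A` by a sum over `g` of probabilities of the
exchanged events. Every condition involved is local, so for clopen `A` the bound passes to the weak
limit, and by regularity it holds for all Borel sets (`measure_le_sum_exchangeMeasure`).

The choice of `g` in a finite tree depends on the whole tree and has no limit, so `f` is built from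
the limiting inequality alone. If `μ` (the law restricted to local non-connection of `x` and `y`) is
at most the sum of `k` measures `ρ g`, Hahn decompositions cover almost all of the space by sets `H
g` on which `μ ≤ 2k ρ g` (`exists_cover_le_smul`). Let `f(ω)` be the first `g` with `ω ∈ H g` that
is exchangeable in `ω`. Since `ρ g` is the law pulled back through the exchange, summing over `g`
gives `P A ≤ 2k² P(π A)` (`exists_selection`). Quasitransitivity bounds `k`, the number of annulus
edges, uniformly in `x`. -/

lemma not_reachable_deleteEdges_of_mem_edges (hH : H.IsAcyclic) {x y : W} {p : H.Walk x y}
    (hp : p.IsPath) {g : Sym2 W} (hg : g ∈ p.edges) : ¬ (H.deleteEdges {g}).Reachable x y := by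
  intro h
  obtain ⟨q, hq⟩ := h.exists_isPath
  have hle : H.deleteEdges {g} ≤ H := deleteEdges_le _
  have := congrArg Subtype.val
    ((hH.subsingleton_path x y).elim ⟨p, hp⟩ ⟨q.mapLe hle, hq.mapLe hle⟩)
  simp only at this
  rw [this, Walk.edges_mapLe_eq_edges] at hg
  have := Walk.edges_subset_edgeSet q hg
  simp [edgeSet_deleteEdges] at this

lemma isTree_exchange (hH : H.IsTree) {x y : W} {g : Sym2 W}
    (hsep : ¬ (H.deleteEdges {g}).Reachable x y) : (H.deleteEdges {g} ⊔ edge x y).IsTree := by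
  classical
  have hxy : x ≠ y := by rintro rfl; exact hsep (Reachable.refl _)
  have hac : (H.deleteEdges {g} ⊔ edge x y).IsAcyclic :=
    IsAcyclic.sup_edge_of_not_reachable hsep (hH.isAcyclic.anti (deleteEdges_le _))
  refine ⟨?_, hac⟩
  have : Nonempty W := ⟨x⟩
  refine ⟨fun u v => ?_⟩
  -- Only the deleted edge could fail to be bridged. If it did, putting it back would keep the graph
  -- acyclic, although that graph contains the tree `H` together with `xy`; this forces `xy` to be
  -- an edge of `H`, and both `xy = g` and `xy ≠ g` are contradictory.
  have key : ∀ a b, H.Adj a b → (H.deleteEdges {g} ⊔ edge x y).Reachable a b := by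
    intro a b hab
    by_contra hnr
    have hg : s(a, b) = g := by
      by_contra hne
      exact hnr (Adj.reachable (Or.inl (by simp [hab, hne])))
    have h1 := IsAcyclic.sup_edge_of_not_reachable hnr hac
    have hle : H ⊔ edge x y ≤ H.deleteEdges {g} ⊔ edge x y ⊔ edge a b := by
      intro c d hcd
      rcases hcd with hcd | hcd
      · by_cases hc : s(c, d) = g
        · right
          rw [adj_edge]
          exact ⟨hg.trans hc.symm, hcd.ne⟩
        · left; left; simp [hcd, hc]
      · left; right; exact hcd
    rcases (isAcyclic_sup_fromEdgeSet_iff.mp (h1.anti hle)).2 (hH.connected x y) with h | h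
    · exact hxy h
    · by_cases hc : s(x, y) = g
      · apply hnr
        refine Adj.reachable (Or.inr ?_)
        rw [adj_edge]
        exact ⟨hc.trans hg.symm, hab.ne⟩
      · exact hsep (Adj.reachable (by simp [h, hc]))
  obtain ⟨p⟩ := hH.connected u v
  induction p with
  | nil => exact Reachable.refl _
  | cons h _ ih => exact (key _ _ h).trans ih

end Tree

/-! ### Exchange across an annulus, for free and wired spanning trees -/

variable {V : Type*} {G : SimpleGraph V}

/-- The edges of `G` inside the ball of radius `R` about `x`. -/
def ballEdges (G : SimpleGraph V) (x : V) (R : ℕ) : Set G.edgeSet :=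
  {g | ∀ v ∈ (g : Sym2 V), G.dist x v ≤ R}

/-- The edges of `G` whose endpoints have distance `r + 1` or `r + 2` from `x`. -/
def annulus (G : SimpleGraph V) (x : V) (r : ℕ) : Set G.edgeSet :=
  {g | ∀ v ∈ (g : Sym2 V), r < G.dist x v ∧ G.dist x v ≤ r + 2}

/-- The subgraph formed by the edges of `ω` inside the ball of radius `R` about `x`. -/
def localGraph (ω : Config G) (x : V) (R : ℕ) : SimpleGraph V :=
  fromEdgeSet {e | ∃ h : e ∈ G.edgeSet, ω ⟨e, h⟩ = true ∧ ∀ v ∈ e, G.dist x v ≤ R}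

lemma graph_adj {ω : Config G} {u v : V} :
    ω.graph.Adj u v ↔ ∃ h : G.Adj u v, ω ⟨s(u, v), h⟩ = true := by
  simp only [Config.graph, fromEdgeSet_adj, Set.mem_ofPred_eq, mem_edgeSet]
  exact ⟨fun h => h.1, fun h => ⟨h, h.1.ne⟩⟩

lemma localGraph_adj {ω : Config G} {x u v : V} {R : ℕ} :
    (localGraph ω x R).Adj u v ↔ ω.graph.Adj u v ∧ G.dist x u ≤ R ∧ G.dist x v ≤ R := by
  simp only [localGraph, fromEdgeSet_adj, Set.mem_ofPred_eq, mem_edgeSet, graph_adj, Sym2.mem_iff,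
    forall_eq_or_imp, forall_eq]
  exact ⟨fun ⟨⟨h, h'⟩, _⟩ => ⟨⟨h, h'.1⟩, h'.2⟩, fun ⟨⟨h, h'⟩, h2⟩ => ⟨⟨h, h', h2⟩, h.ne⟩⟩

lemma localGraph_le (ω : Config G) (x : V) (R : ℕ) : localGraph ω x R ≤ ω.graph :=
  fun _ _ h => (localGraph_adj.1 h).1

lemma graph_le (ω : Config G) : ω.graph ≤ G := fun _ _ h => (graph_adj.1 h).1

/-- A configuration containing the edge `g`, whose endpoints are connected to `x` inside the ball of
radius `r + 2`, and not containing the edge `e`. -/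
def Exchangeable (e : G.edgeSet) (x : V) (r : ℕ) (g : G.edgeSet) (ω : Config G) : Prop :=
  ω e = false ∧ ω g = true ∧ ∀ v ∈ (g : Sym2 V), (localGraph ω x (r + 2)).Reachable x v

/-- A family of sets of configurations that behaves like the spanning trees of finite subgraphs:
locally there are no cycles, and if `x` and `y` are not connected locally, the edge `xy` can be
exchanged for an edge of the annulus about `x`. -/
structure IsTreeFamily (G : SimpleGraph V) (trees : Finset V → Set (Config G)) : Prop where
  no_cycle : ∀ (S : Finset V), ∀ ω ∈ trees S, ∀ (v : V) (c : ω.graph.Walk v v), c.IsCycle →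
    ¬ ∀ u ∈ c.support, u ∈ S
  exchange : ∀ (S : Finset V) (x y : V) (h : G.Adj x y) (r : ℕ), (∀ v, G.dist x v ≤ r + 2 → v ∈ S) →
    ∀ ω ∈ trees S, ¬ (localGraph ω x (r + 2)).Reachable x y →
      ∃ g ∈ annulus G x r, Exchangeable ⟨s(x, y), h⟩ x r g ω ∧
        insDel ⟨s(x, y), h⟩ (some g) ω ∈ trees S

/-- Distances from `x` change by at most one along the walk, so it cannot go from distance at most
`r` to `r + 2` without traversing an edge whose ends both exceed `r`. Before such an edge it stays
within distance `r + 1`, and every vertex met is locally connected to `x`; without one it would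
connect `x` to `y` locally. Up to there `hloc` identifies steps of `H` with edges of `ω`, which in
the wired case keeps the walk away from the extra vertex. -/
lemma exists_annulus_edge {W : Type*} {H : SimpleGraph W} {S : Finset V} (i : S → W)
    {ω : Config G} {x y : V} {r : ℕ} (hG : G.Connected)
    (hi : Function.Injective i)
    (hloc : ∀ (u : S) (w : W), G.dist x u ≤ r + 1 → H.Adj (i u) w → ∃ v : S, w = i v ∧
      ω.graph.Adj u v) (hy : y ∈ S) :
    ∀ {a b : W} (p : H.Walk a b) (u : S), a = i u → b = i ⟨y, hy⟩ → G.dist x u ≤ r + 1 →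
      (localGraph ω x (r + 2)).Reachable x u → ¬ (localGraph ω x (r + 2)).Reachable x y →
      ∃ c d : S, s(i c, i d) ∈ p.edges ∧ ω.graph.Adj c d ∧
        (∀ v ∈ s((c : V), (d : V)), r < G.dist x v ∧ G.dist x v ≤ r + 2) ∧
        (∀ v ∈ s((c : V), (d : V)), (localGraph ω x (r + 2)).Reachable x v) := by
  intro a b p
  induction p with
  | nil =>
    intro u hu hb _ hr hn
    have : u = ⟨y, hy⟩ := hi (hu.symm.trans hb)
    subst this
    exact absurd hr hn
  | @cons a w b haw q ih =>
    rintro u rfl hb hd hr hn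
    obtain ⟨v, rfl, huv⟩ := hloc u w hd haw
    have hG' : G.dist u v = 1 := dist_eq_one_iff_adj.2 (graph_le _ huv)
    have t1 : G.dist x v ≤ G.dist x u + G.dist u v := hG.dist_triangle
    have t2 : G.dist x u ≤ G.dist x v + G.dist v u := hG.dist_triangle
    rw [dist_comm (u := (v : V))] at t2
    have hrv : (localGraph ω x (r + 2)).Reachable x v :=
      hr.trans (Adj.reachable (localGraph_adj.2 ⟨huv, by omega, by omega⟩))
    by_cases hc : r < G.dist x u ∧ r < G.dist x v
    · refine ⟨u, v, by simp, huv, ?_, ?_⟩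
      · simp only [Sym2.mem_iff, forall_eq_or_imp, forall_eq]
        omega
      · simp only [Sym2.mem_iff, forall_eq_or_imp, forall_eq]
        exact ⟨hr, hrv⟩
    -- One end has distance at most `r`, so the next vertex again has distance at most `r + 1`.
    · obtain ⟨c, d, h1, h2⟩ := ih v rfl hb (by omega) hrv hn
      exact ⟨c, d, by simp [h1], h2⟩

lemma edge_false_of_not_reachable {ω : Config G} {x y : V} (h : G.Adj x y) {r : ℕ}
    (hn : ¬ (localGraph ω x (r + 2)).Reachable x y) : ω ⟨s(x, y), h⟩ = false := by
  by_contra hc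
  refine hn (Adj.reachable (localGraph_adj.2 ⟨graph_adj.2 ⟨h, by simpa using hc⟩, by simp, ?_⟩))
  rw [dist_eq_one_iff_adj.2 h]; omega

/-- The tree exchange, for a tree `H` on a vertex set containing `S`. -/
lemma exists_exchange {W : Type*} {H : SimpleGraph W} {S : Finset V} (i : S → W)
    {ω : Config G} {x y : V} (h : G.Adj x y) {r : ℕ} (hG : G.Connected) (hH : H.IsTree)
    (hi : Function.Injective i)
    (hloc : ∀ (u : S) (w : W), G.dist x u ≤ r + 1 → H.Adj (i u) w → ∃ v : S, w = i v ∧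
      ω.graph.Adj u v) (hx : x ∈ S) (hy : y ∈ S)
    (hn : ¬ (localGraph ω x (r + 2)).Reachable x y) :
    ∃ (c d : S) (hcd : G.Adj c d), (⟨s(↑c, ↑d), hcd⟩ : G.edgeSet) ∈ annulus G x r ∧
      Exchangeable ⟨s(x, y), h⟩ x r ⟨s(↑c, ↑d), hcd⟩ ω ∧
      (H.deleteEdges {s(i c, i d)} ⊔ edge (i ⟨x, hx⟩) (i ⟨y, hy⟩)).IsTree := by
  obtain ⟨p, hp⟩ := (hH.connected (i ⟨x, hx⟩) (i ⟨y, hy⟩)).exists_isPath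
  obtain ⟨c, d, h1, h2, h3, h4⟩ := exists_annulus_edge i hG hi hloc hy p ⟨x, hx⟩ rfl rfl
    (by simp) (Reachable.refl _) hn
  obtain ⟨hcd, h2⟩ := graph_adj.1 h2
  exact ⟨c, d, hcd, h3, ⟨edge_false_of_not_reachable h hn, h2, h4⟩,
    isTree_exchange hH (not_reachable_deleteEdges_of_mem_edges hH.isAcyclic hp h1)⟩

lemma insDel_eq_true_iff {e g g' : G.edgeSet} {ω : Config G} :
    insDel e (some g) ω g' = true ↔ g' ≠ g ∧ (g' = e ∨ ω g' = true) := by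
  unfold insDel
  by_cases h : g' = g
  · simp [h]
  · by_cases h' : g' = e <;> simp [h, h', Ne.symm h]
    exact not_congr eq_comm

theorem isTreeFamily_freeTrees (hG : G.Connected) : IsTreeFamily G (freeTrees G) where
  no_cycle := by
    intro S ω hω v c hc hs
    refine hω.2.isAcyclic (c.induce (S : Set V) hs) ?_
    refine Walk.IsCycle.of_map (f := (Embedding.induce _).toHom) ?_
    rw [Walk.map_induce]
    exact hc
  exchange := by
    intro S x y h r hS ω hω hn
    have hx : x ∈ S := hS x (by simp)
    have hy : y ∈ S := hS y (by rw [dist_eq_one_iff_adj.2 h]; omega)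
    obtain ⟨c, d, hcd, h1, h2, h3⟩ := exists_exchange (W := (S : Set V)) id h hG hω.2
      Function.injective_id (fun u w _ hw => ⟨w, rfl, hw⟩) hx hy hn
    have hne : (⟨s(x, y), h⟩ : G.edgeSet) ≠ ⟨s(↑c, ↑d), hcd⟩ := by
      intro heq
      have := h2.1
      rw [heq, h2.2.1] at this
      exact Bool.noConfusion this
    refine ⟨_, h1, h2, ?_, ?_⟩
    · intro e he v hv
      rcases (insDel_eq_true_iff.1 he).2 with rfl | he
      · rcases Sym2.mem_iff.1 hv with rfl | rfl <;> assumption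
      · exact hω.1 e he v hv
    · convert h3 using 1
      have inj : ∀ a b c d : S, s(a, b) = s(c, d) ↔ s((a : V), (b : V)) = s((c : V), (d : V)) :=
        fun a b c d => (Sym2.map.injective Subtype.val_injective).eq_iff.symm
      ext u v
      rw [comap_adj, graph_adj, sup_adj, deleteEdges_adj, comap_adj, graph_adj, adj_edge,
        Set.mem_singleton_iff, inj, inj]
      simp only [insDel_eq_true_iff, Function.Embedding.subtype_apply, ne_eq, Subtype.ext_iff, id]
      have hcx : s((x : V), y) ≠ s((c : V), (d : V)) := fun h => hne (Subtype.ext h)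
      constructor
      · rintro ⟨huv, ha, hb | hb⟩
        · exact Or.inr ⟨hb.symm, huv.ne⟩
        · exact Or.inl ⟨⟨huv, hb⟩, ha⟩
      · rintro (⟨⟨huv, hb⟩, ha⟩ | ⟨ha, hb⟩)
        · exact ⟨huv, ha, Or.inr hb⟩
        · exact ⟨by rw [← mem_edgeSet, ← ha]; exact h, ha ▸ hcx, Or.inl ha.symm⟩

lemma collapse_of_mem {S : Finset V} {v : V} (h : v ∈ S) : collapse S v = some ⟨v, h⟩ := by
  simp [collapse, h]

lemma collapse_eq_some {S : Finset V} {v : V} {w : S} : collapse S v = some w ↔ v = w := by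
  constructor
  · intro h
    unfold collapse at h
    split_ifs at h with hv
    cases h; rfl
  · rintro rfl
    exact collapse_of_mem w.2

lemma map_collapse_eq {S : Finset V} {e : Sym2 V} {a b : S}
    (h : Sym2.map (collapse S) e = s(some a, some b)) : e = s((a : V), (b : V)) := by
  induction e with
  | _ u v =>
    rw [Sym2.map_mk] at h
    rcases Sym2.eq_iff.1 h with ⟨h1, h2⟩ | ⟨h1, h2⟩
    · rw [collapse_eq_some.1 h1, collapse_eq_some.1 h2]
    · rw [collapse_eq_some.1 h1, collapse_eq_some.1 h2, Sym2.eq_swap]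

/-- The simple graph formed by a wired spanning tree. -/
def wiredGraph (S : Finset V) (ω : Config G) : SimpleGraph (Option S) :=
  fromEdgeSet ((fun e : G.edgeSet => Sym2.map (collapse S) (e : Sym2 V)) '' {e | ω e = true})

lemma wiredGraph_adj {S : Finset V} {ω : Config G} {a b : Option S} :
    (wiredGraph S ω).Adj a b ↔
      (∃ e : G.edgeSet, ω e = true ∧ Sym2.map (collapse S) (e : Sym2 V) = s(a, b)) ∧ a ≠ b := by
  simp [wiredGraph]

theorem isTreeFamily_wiredTrees (hG : G.Connected) : IsTreeFamily G (wiredTrees G) where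
  no_cycle := by
    intro S ω hω v c hc hs
    have hac : (wiredGraph S ω).IsAcyclic := hω.2.2.isAcyclic
    let f : ω.graph.induce (S : Set V) →g wiredGraph S ω :=
      ⟨fun u => some u, by
        intro u v huv
        obtain ⟨h, h'⟩ := graph_adj.1 (comap_adj.1 huv)
        refine wiredGraph_adj.2 ⟨⟨_, h', ?_⟩, fun h2 => huv.ne (Option.some_injective _ h2)⟩
        simp only [Sym2.map_mk, Function.Embedding.subtype_apply]
        rw [collapse_of_mem u.2, collapse_of_mem v.2]
        rfl⟩
    have hac' : (ω.graph.induce (S : Set V)).IsAcyclic :=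
      IsAcyclic.comap f (fun _ _ h => Option.some_injective _ h) hac
    refine hac' (c.induce (S : Set V) hs) ?_
    refine Walk.IsCycle.of_map (f := (Embedding.induce _).toHom) ?_
    rw [Walk.map_induce]
    exact hc
  exchange := by
    intro S x y h r hS ω hω hn
    have hx : x ∈ S := hS x (by simp)
    have hy : y ∈ S := hS y (by rw [dist_eq_one_iff_adj.2 h]; omega)
    obtain ⟨hdiag, hinj, htree⟩ := hω
    change (wiredGraph S ω).IsTree at htree
    obtain ⟨c, d, hcd, h1, h2, h3⟩ := exists_exchange (W := Option S) some h hG htree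
      (Option.some_injective _) (by
        intro u w hu huw
        obtain ⟨⟨⟨e, he⟩, h1, h2⟩, h3⟩ := wiredGraph_adj.1 huw
        obtain ⟨v, hv⟩ : ∃ v, e = s((u : V), v) := by
          have : some u ∈ Sym2.map (collapse S) e := by rw [h2]; simp
          obtain ⟨u', hu', hu''⟩ := Sym2.mem_map.1 this
          rw [collapse_eq_some.1 hu''] at hu'
          exact hu'
        subst hv
        -- A neighbour of a vertex at distance at most `r + 1` lies in the ball of radius `r + 2`,
        -- hence is not collapsed.
        have hv : v ∈ S := by
          apply hS
          have t1 : G.dist x v ≤ G.dist x u + G.dist u v := hG.dist_triangle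
          rw [dist_eq_one_iff_adj.2 he] at t1
          omega
        refine ⟨⟨v, hv⟩, ?_, graph_adj.2 ⟨he, h1⟩⟩
        simp only [Sym2.map_mk] at h2
        rw [collapse_of_mem u.2, collapse_of_mem hv] at h2
        exact (Sym2.congr_right.1 h2).symm) hx hy hn
    set g : G.edgeSet := ⟨s(↑c, ↑d), hcd⟩
    set e : G.edgeSet := ⟨s(x, y), h⟩
    have hne : e ≠ g := by
      intro heq
      have := h2.1
      rw [heq, h2.2.1] at this
      exact Bool.noConfusion this
    have hge : Sym2.map (collapse S) (g : Sym2 V) = s(some c, some d) := by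
      simp only [g, Sym2.map_mk, collapse_of_mem c.2, collapse_of_mem d.2]
    have hee : Sym2.map (collapse S) (e : Sym2 V) = s(some ⟨x, hx⟩, some ⟨y, hy⟩) := by
      simp only [e, Sym2.map_mk, collapse_of_mem hx, collapse_of_mem hy]
    have hxy : (some ⟨x, hx⟩ : Option S) ≠ some ⟨y, hy⟩ := by
      intro h2; exact h.ne (congrArg Subtype.val (Option.some_injective _ h2))
    -- Collapsing is injective on edges with both ends in `S`, so inserting `e` creates no parallel
    -- edges.
    have huniq : ∀ e' : G.edgeSet,
        Sym2.map (collapse S) (e' : Sym2 V) = Sym2.map (collapse S) (e : Sym2 V) → e' = e := by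
      intro e' he'
      rw [hee] at he'
      exact Subtype.ext (map_collapse_eq he')
    refine ⟨g, h1, h2, ?_, ?_, ?_⟩
    · intro e' he'
      rcases (insDel_eq_true_iff.1 he').2 with rfl | he'
      · simp only [hee, Sym2.mk_isDiag_iff]; exact hxy
      · exact hdiag e' he'
    · intro a ha b hb hab
      rcases (insDel_eq_true_iff.1 ha).2 with rfl | ha
      · exact (huniq b hab.symm).symm
      · rcases (insDel_eq_true_iff.1 hb).2 with rfl | hb
        · exact huniq a hab
        · exact hinj ha hb hab
    · convert h3 using 1
      change wiredGraph S _ = _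
      ext u v
      rw [wiredGraph_adj, sup_adj, deleteEdges_adj, wiredGraph_adj, adj_edge,
        Set.mem_singleton_iff, ← hge, ← hee]
      constructor
      · rintro ⟨⟨e', he', huv⟩, hne'⟩
        obtain ⟨ha, rfl | hb⟩ := insDel_eq_true_iff.1 he'
        · exact Or.inr ⟨huv, hne'⟩
        · exact Or.inl ⟨⟨⟨e', hb, huv⟩, hne'⟩, fun h4 => ha (hinj hb h2.2.1 (huv.trans h4))⟩
      · rintro (⟨⟨⟨e', hb, huv⟩, hne'⟩, h4⟩ | ⟨huv, hne'⟩)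
        · refine ⟨⟨e', insDel_eq_true_iff.2 ⟨?_, Or.inr hb⟩, huv⟩, hne'⟩
          rintro rfl
          exact h4 huv.symm
        · exact ⟨⟨e, insDel_eq_true_iff.2 ⟨hne, Or.inl rfl⟩, huv⟩, hne'⟩

end USF

namespace USF

open SimpleGraph
open scoped ENNReal

/-! ### Domination of measures and measurable choice -/

section Measure

/-- An open set is an increasing union of countably many clopen sets, which gives the inequality for
open sets; outer regularity of `ν` then gives it for measurable sets. -/
lemma measure_le_of_forall_isClopen {X : Type*} [TopologicalSpace X] [CompactSpace X] [T2Space X]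
    [TotallyDisconnectedSpace X] [SecondCountableTopology X] [MeasurableSpace X] [BorelSpace X]
    {μ ν : Measure X} [ν.OuterRegular]
    (h : ∀ A, IsClopen A → μ A ≤ ν A) : μ ≤ ν := by
  have hopen : ∀ U, IsOpen U → μ U ≤ ν U := by
    intro U hU
    obtain ⟨s, hs, rfl⟩ := isTopologicalBasis_isClopen.open_eq_sUnion hU
    obtain ⟨T, hT, hTs, hTU⟩ := TopologicalSpace.isOpen_sUnion_countable s
      (fun t ht => (hs ht).isOpen)
    rw [← hTU]
    rcases T.eq_empty_or_nonempty with rfl | hne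
    · simp
    obtain ⟨f, rfl⟩ := hT.exists_eq_range hne
    rw [Set.sUnion_range, measure_iUnion_eq_iSup_accumulate, measure_iUnion_eq_iSup_accumulate]
    refine iSup_mono fun i => h _ ?_
    rw [Set.accumulate_def]
    exact (Set.finite_Iic i).isClopen_biUnion fun j _ => hs (hTs ⟨j, rfl⟩)
  refine Measure.le_iff.2 fun A _ => le_of_forall_gt fun r hr => ?_
  obtain ⟨U, hAU, hU, hlt⟩ := A.exists_isOpen_lt_of_lt r hr
  exact (measure_mono hAU).trans_lt ((hopen U hU).trans_lt hlt)

/-- If `μ` is dominated by a sum of measures, then almost all of the space is covered by sets on which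
`μ` is dominated by a multiple of one of the summands. -/
lemma exists_cover_le_smul {X ι : Type*} [MeasurableSpace X] (K : Finset ι) (μ : Measure X)
    [IsFiniteMeasure μ] (ρ : ι → Measure X) [∀ g, IsFiniteMeasure (ρ g)]
    (h : ∀ A, MeasurableSet A → μ A ≤ ∑ g ∈ K, ρ g A) :
    ∃ H : ι → Set X, (∀ g, MeasurableSet (H g)) ∧
      (∀ g t, MeasurableSet t → t ⊆ H g → μ t ≤ (2 * K.card : ℕ) * ρ g t) ∧
      μ (⋂ g ∈ K, (H g)ᶜ) = 0 := by
  have hex : ∀ g, ∃ s, MeasurableSet s ∧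
      (∀ t, MeasurableSet t → t ⊆ s → μ t ≤ (((2 * K.card : ℕ) : ℝ≥0) • ρ g) t) ∧
      ∀ t, MeasurableSet t → t ⊆ sᶜ → (((2 * K.card : ℕ) : ℝ≥0) • ρ g) t ≤ μ t :=
    fun g => hahn_decomposition _ _
  choose H hm h1 h2 using hex
  have hsm : ∀ g t, (((2 * K.card : ℕ) : ℝ≥0) • ρ g) t = (2 * K.card : ℕ) * ρ g t := by
    intro g t
    simp [ENNReal.smul_def]
  refine ⟨H, hm, fun g t ht hs => (h1 g t ht hs).trans_eq (hsm g t), ?_⟩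
  set W := ⋂ g ∈ K, (H g)ᶜ with hW
  have hWm : MeasurableSet W := K.measurableSet_biInter fun g _ => (hm g).compl
  by_contra hne
  -- Off every `H g` the reverse inequalities `2k ρ g ≤ μ` hold. The factor 2 makes their sum
  -- incompatible with the domination hypothesis unless `μ W = 0` or `k = 0`.
  have hsum : ((2 * K.card : ℕ) : ℝ≥0∞) * μ W ≤ K.card * μ W := by
    calc ((2 * K.card : ℕ) : ℝ≥0∞) * μ W ≤ (2 * K.card : ℕ) * ∑ g ∈ K, ρ g W := by
          gcongr; exact h W hWm
      _ = ∑ g ∈ K, (2 * K.card : ℕ) * ρ g W := Finset.mul_sum _ _ _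
      _ ≤ ∑ g ∈ K, μ W := Finset.sum_le_sum fun g hg => by
          rw [← hsm]; exact h2 g W hWm (Set.biInter_subset_of_mem hg)
      _ = K.card * μ W := by simp
  rw [ENNReal.mul_le_mul_iff_left hne (measure_ne_top μ W)] at hsum
  have hk : K.card = 0 := by
    have : 2 * K.card ≤ K.card := by exact_mod_cast hsum
    omega
  rw [Finset.card_eq_zero] at hk
  subst hk
  exact hne (by simpa using h W hWm)

lemma measurable_find {X ι : Type*} [MeasurableSpace X] (p : X → ι → Bool)
    (hp : ∀ g, MeasurableSet {ω | p ω g = true}) (l : List ι) :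
    @Measurable X (Option ι) _ ⊤ (fun ω => l.find? (p ω)) := by
  let _ : MeasurableSpace (Option ι) := ⊤
  induction l with
  | nil => exact measurable_const
  | cons a l ih =>
    have : (fun ω => (a :: l).find? (p ω)) =
        fun ω => if p ω a = true then some a else l.find? (p ω) := by
      funext ω
      rw [List.find?_cons]
      cases p ω a <;> simp
    rw [this]
    exact Measurable.ite (hp a) measurable_const ih

/-- Taking images does not increase cardinality, so no injectivity of `b g` is needed. In the
application `b g` undoes the exchange for `g`. -/
lemma uniformOn_le_sum {X ι : Type*} [MeasurableSpace X] [MeasurableSingletonClass X]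
    {s : Set X} (hs : s.Finite) (K : Finset ι) (A : Set X) (M : ι → Set X) (b : ι → X → X)
    (h : ∀ ω ∈ s, ω ∈ A → ∃ g ∈ K, ω ∈ b g '' (s ∩ M g)) :
    ProbabilityTheory.uniformOn s A ≤ ∑ g ∈ K, ProbabilityTheory.uniformOn s (M g) := by
  simp only [ProbabilityTheory.uniformOn, ProbabilityTheory.cond_apply hs.measurableSet]
  rw [← Finset.mul_sum]
  gcongr
  calc Measure.count (s ∩ A) ≤ Measure.count (⋃ g ∈ K, b g '' (s ∩ M g)) :=
        measure_mono fun ω hω => by simpa using h ω hω.1 hω.2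
    _ ≤ ∑ g ∈ K, Measure.count (b g '' (s ∩ M g)) := measure_biUnion_finset_le _ _
    _ ≤ ∑ g ∈ K, Measure.count (s ∩ M g) := Finset.sum_le_sum fun g _ => by
        have hf : (s ∩ M g).Finite := hs.inter_of_left _
        rw [Measure.count_apply hf.measurableSet, Measure.count_apply (hf.image _).measurableSet]
        exact_mod_cast Set.encard_image_le _ _

end Measure

/-! ### Local events and uniform size of annuli -/

variable {V : Type*} {G : SimpleGraph V}

lemma isClopen_of_depends_on_finite {K : Set G.edgeSet} (hK : K.Finite) {p : Config G → Prop}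
    (hp : ∀ ω ω' : Config G, (∀ e ∈ K, ω e = ω' e) → p ω → p ω') : IsClopen {ω | p ω} := by
  have : Finite K := hK
  have heq : {ω | p ω} = K.domRestrict ⁻¹' (K.domRestrict '' {ω : Config G | p ω}) := by
    refine Set.Subset.antisymm (Set.subset_preimage_image _ _) ?_
    rintro ω ⟨ω', h1, h2⟩
    exact hp ω' ω (fun e he => congrFun h2 ⟨e, he⟩) h1
  rw [heq]
  exact (isClopen_discrete _).preimage (by unfold Set.domRestrict; fun_prop)

lemma finite_ball (hG : G.Connected) [G.LocallyFinite] (x : V) (R : ℕ) :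
    {v | G.dist x v ≤ R}.Finite := by
  induction R with
  | zero =>
    refine (Set.finite_singleton x).subset fun v hv => ?_
    exact (hG.dist_eq_zero_iff.1 (Nat.le_zero.1 hv)).symm
  | succ R ih =>
    refine (ih.union (ih.biUnion fun v _ => (G.neighborSet v).toFinite)).subset fun v hv => ?_
    rcases Nat.lt_or_ge R (G.dist x v) with h | h
    · right
      obtain ⟨p, hp⟩ := hG.exists_walk_length_eq_dist v x
      cases p with
      | nil => simp at h
      | @cons _ w _ hvw q =>
        simp only [Set.mem_iUnion]
        refine ⟨w, ?_, hvw.symm⟩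
        have := dist_le q
        rw [dist_comm] at this
        rw [Walk.length_cons, dist_comm] at hp
        have hv : G.dist x v ≤ R + 1 := hv
        change G.dist x w ≤ R
        omega
    · exact Or.inl h

lemma finite_ballEdges (hG : G.Connected) [G.LocallyFinite] (x : V) (R : ℕ) :
    (ballEdges G x R).Finite := by
  have h := finite_ball hG x R
  refine Set.Finite.of_finite_image (f := Subtype.val) ?_ Subtype.val_injective.injOn
  refine ((h.prod h).image fun p => s(p.1, p.2)).subset ?_
  rintro _ ⟨⟨e, he⟩, hg, rfl⟩
  induction e with
  | _ u v => exact ⟨(u, v), ⟨hg u (by simp), hg v (by simp)⟩, rfl⟩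

lemma annulus_subset (x : V) (r : ℕ) : annulus G x r ⊆ ballEdges G x (r + 2) :=
  fun _ hg v hv => (hg v hv).2

lemma finite_annulus (hG : G.Connected) [G.LocallyFinite] (x : V) (r : ℕ) :
    (annulus G x r).Finite := (finite_ballEdges hG x _).subset (annulus_subset x r)

lemma localGraph_congr {x : V} {R : ℕ} {ω ω' : Config G}
    (h : ∀ e ∈ ballEdges G x R, ω e = ω' e) : localGraph ω x R = localGraph ω' x R := by
  unfold localGraph
  congr 1
  ext e
  constructor
  · rintro ⟨he, h1, h2⟩
    exact ⟨he, (h ⟨e, he⟩ h2).symm.trans h1, h2⟩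
  · rintro ⟨he, h1, h2⟩
    exact ⟨he, (h ⟨e, he⟩ h2).trans h1, h2⟩

lemma isClopen_not_reachable (hG : G.Connected) [G.LocallyFinite] (x y : V) (R : ℕ) :
    IsClopen {ω : Config G | ¬ (localGraph ω x R).Reachable x y} :=
  isClopen_of_depends_on_finite (finite_ballEdges hG x R) fun ω ω' h => by
    rw [localGraph_congr h]; exact id

lemma isClopen_exchangeable (hG : G.Connected) [G.LocallyFinite] (e : G.edgeSet) (x : V) (r : ℕ)
    (g : G.edgeSet) : IsClopen {ω : Config G | Exchangeable e x r g ω} :=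
  isClopen_of_depends_on_finite (K := {e, g} ∪ ballEdges G x (r + 2))
    ((Set.toFinite _).union (finite_ballEdges hG x _)) fun ω ω' h => by
      unfold Exchangeable
      rw [localGraph_congr fun e he => h e (Or.inr he), h e (by simp), h g (by simp)]
      exact id

lemma continuous_insDel (e g : G.edgeSet) : Continuous (insDel e (some g) : Config G → Config G) := by
  refine continuous_pi fun g' => ?_
  unfold insDel
  split_ifs <;> fun_prop

lemma insDel_insDel {e g : G.edgeSet} {ω : Config G} (he : ω e = false) (hg : ω g = true) :
    insDel g (some e) (insDel e (some g) ω) = ω := by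
  funext g'
  simp only [insDel, Option.some.injEq]
  split_ifs with h1 h2 h3 h4 <;> simp_all

lemma insDel_apply_self {e g : G.edgeSet} {ω : Config G} : insDel e (some g) ω g = false := by
  simp [insDel]

lemma insDel_apply_of_ne {e g : G.edgeSet} {ω : Config G} (h : e ≠ g) :
    insDel e (some g) ω e = true := by
  simp [insDel, h.symm]

/-- The configurations in which `e` can be exchanged for `g`, the result being an exchangeable
configuration. -/
def exchangeDomain (e : G.edgeSet) (x : V) (r : ℕ) (g : G.edgeSet) : Set (Config G) :=
  {ω | (ω e = true ∧ ω g = false) ∧ Exchangeable e x r g (insDel g (some e) ω)}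

lemma isClopen_exchangeDomain (hG : G.Connected) [G.LocallyFinite] (e : G.edgeSet) (x : V) (r : ℕ)
    (g : G.edgeSet) : IsClopen (exchangeDomain e x r g) := by
  refine IsClopen.inter ?_ ((isClopen_exchangeable hG e x r g).preimage (continuous_insDel g e))
  exact isClopen_of_depends_on_finite (K := {e, g}) (Set.toFinite _) fun ω ω' h => by
    rw [h e (by simp), h g (by simp)]
    exact id

lemma dist_iso_le (hG : G.Connected) (φ : G ≃g G) (u v : V) : G.dist (φ u) (φ v) ≤ G.dist u v := by
  obtain ⟨p, hp⟩ := hG.exists_walk_length_eq_dist u v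
  rw [← hp, ← Walk.length_map φ.toHom p]
  exact dist_le _

lemma dist_iso (hG : G.Connected) (φ : G ≃g G) (u v : V) : G.dist (φ u) (φ v) = G.dist u v := by
  refine le_antisymm (dist_iso_le hG φ u v) ?_
  simpa using dist_iso_le hG φ.symm (φ u) (φ v)

/-- Automorphisms preserve distances and so embed each annulus in one centred at an orbit
representative. This is the source of the uniformity of `δ`. -/
lemma exists_ncard_annulus_le (hG : G.Connected) [G.LocallyFinite] (hqt : IsQuasitransitive G)
    (r : ℕ) : ∃ N, ∀ x, (annulus G x r).ncard ≤ N := by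
  obtain ⟨F, hF⟩ := hqt
  refine ⟨F.sup fun x => (annulus G x r).ncard, fun x => ?_⟩
  obtain ⟨φ, hφ⟩ := hF x
  refine le_trans ?_ (Finset.le_sup (f := fun x => (annulus G x r).ncard) hφ)
  refine Set.ncard_le_ncard_of_injOn φ.mapEdgeSet ?_ φ.mapEdgeSet.injective.injOn
    (finite_annulus hG _ r)
  rintro ⟨e, he⟩ hg v hv
  obtain ⟨u, hu, rfl⟩ := Sym2.mem_map.1 hv
  change r < G.dist (φ x) (φ u) ∧ G.dist (φ x) (φ u) ≤ r + 2
  rw [dist_iso hG]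
  exact hg u hu

lemma IsExhaustion.eventually_subset {S : ℕ → Finset V} (hS : IsExhaustion G S) {B : Set V}
    (hB : B.Finite) : ∀ᶠ n in atTop, ∀ v ∈ B, v ∈ S n := by
  rw [hB.eventually_all]
  intro v _
  obtain ⟨n, hn⟩ := hS.exhausts v
  exact eventually_atTop.2 ⟨n, fun m hm => hS.mono hm hn⟩

lemma finite_of_eq_uniformOn {s : Set (Config G)} {ν : ProbabilityMeasure (Config G)}
    (h : (ν : Measure (Config G)) = ProbabilityTheory.uniformOn s) : s.Finite :=
  ProbabilityTheory.finite_of_uniformOn_ne_zero (t := Set.univ) (by rw [← h]; simp)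

end USF

namespace USF

open SimpleGraph
open scoped ENNReal

/-! ### Passage to the weak limit and construction of the selection -/

variable {V : Type*} {G : SimpleGraph V} [Countable V]

lemma tendsto_measure_of_isClopen {P : ProbabilityMeasure (Config G)}
    {ν : ℕ → ProbabilityMeasure (Config G)} (h : Tendsto ν atTop (𝓝 P)) {A : Set (Config G)}
    (hA : IsClopen A) :
    Tendsto (fun n => (ν n : Measure (Config G)) A) atTop (𝓝 ((P : Measure (Config G)) A)) :=
  ProbabilityMeasure.tendsto_measure_of_null_frontier_of_tendsto' h (by simp [hA.frontier_eq])

lemma ae_isAcyclic {trees : Finset V → Set (Config G)} (ht : IsTreeFamily G trees)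
    {P : ProbabilityMeasure (Config G)} (hP : IsUniformLimit G trees P) :
    ∀ᵐ ω ∂(P : Measure (Config G)), ω.graph.IsAcyclic := by
  classical
  obtain ⟨S, hS, ν, hν, hlim⟩ := hP
  -- Cycles are encoded by their finite edge sets: there are countably many, and the presence of
  -- each one is a clopen event, of probability zero once the exhaustion contains the cycle.
  have key : ∀ F : Finset (Sym2 V), (∃ (v : V) (c : G.Walk v v), c.IsCycle ∧ ∀ e, e ∈ c.edges ↔ e ∈ F) →
      ∀ᵐ ω ∂(P : Measure (Config G)), ¬ ∀ e : G.edgeSet, (e : Sym2 V) ∈ F → ω e = true := by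
    rintro F ⟨v, c, hc, hF⟩
    have hfin : {e : G.edgeSet | (e : Sym2 V) ∈ F}.Finite :=
      F.finite_toSet.preimage Subtype.val_injective.injOn
    have hcl : IsClopen {ω : Config G | ∀ e : G.edgeSet, (e : Sym2 V) ∈ F → ω e = true} :=
      isClopen_of_depends_on_finite hfin fun ω ω' h h1 e he => (h e he).symm.trans (h1 e he)
    rw [ae_iff]
    simp only [not_not]
    refine tendsto_nhds_unique (tendsto_measure_of_isClopen hlim hcl)
      (tendsto_const_nhds.congr' ?_)
    filter_upwards [hS.eventually_subset (B := {u | u ∈ c.support}) (List.finite_toSet _)] with n hn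
    rw [hν n]
    symm
    rw [ProbabilityTheory.uniformOn_eq_zero_iff (finite_of_eq_uniformOn (hν n)),
      Set.eq_empty_iff_forall_notMem]
    rintro ω ⟨h1, h2⟩
    have hcω : ∀ e ∈ c.edges, e ∈ ω.graph.edgeSet := by
      intro e he
      have heG := c.edges_subset_edgeSet he
      have := h2 ⟨e, heG⟩ ((hF e).1 he)
      induction e with
      | _ a b => exact graph_adj.2 ⟨heG, this⟩
    refine ht.no_cycle _ ω h1 v (c.transfer _ hcω) (hc.transfer hcω) ?_
    rw [Walk.support_transfer]
    exact hn
  have hall : ∀ᵐ ω ∂(P : Measure (Config G)), ∀ F : Finset (Sym2 V),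
      (∃ (v : V) (c : G.Walk v v), c.IsCycle ∧ ∀ e, e ∈ c.edges ↔ e ∈ F) →
      ¬ ∀ e : G.edgeSet, (e : Sym2 V) ∈ F → ω e = true := by
    have : Countable (Sym2 V) := Quot.mk_surjective.countable
    exact ae_all_iff.2 fun F => by
      by_cases hF : ∃ (v : V) (c : G.Walk v v), c.IsCycle ∧ ∀ e, e ∈ c.edges ↔ e ∈ F
      · filter_upwards [key F hF] with ω h _ using h
      · exact ae_of_all _ fun _ h => absurd h hF
  filter_upwards [hall] with ω hω v c hc
  refine hω c.edges.toFinset ⟨v, c.mapLe (graph_le ω), hc.mapLe _, fun e => by simp⟩ ?_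
  rintro ⟨e, he⟩ h
  have h := c.edges_subset_edgeSet (List.mem_toFinset.1 h)
  induction e with
  | _ a b => exact (graph_adj.1 h).2

/-- The law of the configuration before the exchange of `e` for `g`. -/
noncomputable def exchangeMeasure (P : ProbabilityMeasure (Config G)) (e : G.edgeSet) (x : V) (r : ℕ)
    (g : G.edgeSet) : Measure (Config G) :=
  ((P : Measure (Config G)).restrict (exchangeDomain e x r g)).map (insDel g (some e))

instance (P : ProbabilityMeasure (Config G)) (e : G.edgeSet) (x : V) (r : ℕ) (g : G.edgeSet) :
    IsFiniteMeasure (exchangeMeasure P e x r g) := by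
  unfold exchangeMeasure; infer_instance

lemma exchangeMeasure_apply (P : ProbabilityMeasure (Config G))
    (e : G.edgeSet) (x : V) (r : ℕ) (g : G.edgeSet) {A : Set (Config G)} (hA : MeasurableSet A) :
    exchangeMeasure P e x r g A =
      (P : Measure (Config G)) (insDel g (some e) ⁻¹' A ∩ exchangeDomain e x r g) := by
  have hm : Measurable (insDel g (some e) : Config G → Config G) :=
    (continuous_insDel g e).measurable
  rw [exchangeMeasure, Measure.map_apply hm hA,
    Measure.restrict_apply (hm hA)]

lemma measure_le_sum_exchangeMeasure {trees : Finset V → Set (Config G)} (ht : IsTreeFamily G trees)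
    (hG : G.Connected) [G.LocallyFinite] {P : ProbabilityMeasure (Config G)}
    (hP : IsUniformLimit G trees P) {x y : V} (h : G.Adj x y) (r : ℕ) :
    (P : Measure (Config G)).restrict {ω | ¬ (localGraph ω x (r + 2)).Reachable x y} ≤
      ∑ g ∈ (finite_annulus hG x r).toFinset, exchangeMeasure P ⟨s(x, y), h⟩ x r g := by
  obtain ⟨S, hS, ν, hν, hlim⟩ := hP
  refine measure_le_of_forall_isClopen fun A hA => ?_
  have hAm : MeasurableSet A := hA.isOpen.measurableSet
  rw [Measure.restrict_apply hAm, Measure.finsetSum_apply]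
  simp only [exchangeMeasure_apply P _ x r _ hAm]
  refine le_of_tendsto_of_tendsto
    (tendsto_measure_of_isClopen hlim (hA.inter (isClopen_not_reachable hG x y (r + 2))))
    (tendsto_finsetSum _ fun g _ => tendsto_measure_of_isClopen hlim
      ((hA.preimage (continuous_insDel g _)).inter (isClopen_exchangeDomain hG _ x r g))) ?_
  filter_upwards [hS.eventually_subset (finite_ball hG x (r + 2))] with n hn
  rw [hν n]
  refine uniformOn_le_sum (finite_of_eq_uniformOn (hν n)) _ _ _
    (fun g => insDel g (some ⟨s(x, y), h⟩)) ?_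
  rintro ω hω ⟨hωA, hωD⟩
  obtain ⟨g, hg, hex, hT⟩ := ht.exchange (S n) x y h r hn ω hω hωD
  have hinv := insDel_insDel hex.1 hex.2.1
  have hne : (⟨s(x, y), h⟩ : G.edgeSet) ≠ g := by
    intro heq
    have := hex.1
    rw [heq, hex.2.1] at this
    exact Bool.noConfusion this
  refine ⟨g, by simpa using hg, insDel ⟨s(x, y), h⟩ (some g) ω, ⟨hT, ?_, ?_, ?_⟩, hinv⟩
  · rw [Set.mem_preimage, hinv]; exact hωA
  · exact ⟨insDel_apply_of_ne hne, insDel_apply_self⟩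
  · rw [hinv]; exact hex

theorem exists_selection {trees : Finset V → Set (Config G)} (ht : IsTreeFamily G trees)
    (hG : G.Connected) [G.LocallyFinite] {P : ProbabilityMeasure (Config G)}
    (hP : IsUniformLimit G trees P) {x y : V} (h : G.Adj x y) (r : ℕ) :
    ∃ f : Config G → Option G.edgeSet, @Measurable (Config G) (Option G.edgeSet) _ ⊤ f ∧
      (∀ ω g, f ω = some g → ω g = true ∧
        ∀ v ∈ (g : Sym2 V), ω.graph.Reachable x v ∧ r < G.dist x v) ∧
      ∀ A, IsSeparatingEvent P x y A → (P : Measure (Config G)) A ≤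
        (2 * (annulus G x r).ncard ^ 2 : ℕ) *
          (P : Measure (Config G)) (insDelEvent ⟨s(x, y), h⟩ f A) := by
  classical
  set e : G.edgeSet := ⟨s(x, y), h⟩
  set K := (finite_annulus hG x r).toFinset with hK
  have hKcard : (annulus G x r).ncard = K.card := Set.ncard_eq_toFinset_card _ _
  set D : Set (Config G) := {ω | ¬ (localGraph ω x (r + 2)).Reachable x y}
  set μ := (P : Measure (Config G)).restrict D
  have hle := measure_le_sum_exchangeMeasure ht hG hP h r
  obtain ⟨H, hHm, hH, hH0⟩ := exists_cover_le_smul K μ (exchangeMeasure P e x r) fun A _ => by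
    rw [← Measure.finsetSum_apply]; exact hle A
  have hXm : ∀ g, MeasurableSet {ω : Config G | Exchangeable e x r g ω} := fun g =>
    (isClopen_exchangeable hG e x r g).isOpen.measurableSet
  -- Membership in `H g` gives the measure bound; exchangeability puts `g` in the component of `x`
  -- and makes the exchange invertible.
  let p : Config G → G.edgeSet → Bool := fun ω g => decide (ω ∈ H g ∧ Exchangeable e x r g ω)
  have hp : ∀ ω g, p ω g = true ↔ ω ∈ H g ∧ Exchangeable e x r g ω := fun ω g => by simp [p]
  let f : Config G → Option G.edgeSet := fun ω => K.toList.find? (p ω)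
  have hfm : @Measurable (Config G) (Option G.edgeSet) _ ⊤ f := by
    refine measurable_find p (fun g => ?_) _
    simp only [hp]
    exact (hHm g).inter (hXm g)
  have hfs : ∀ ω g, f ω = some g → g ∈ K ∧ ω ∈ H g ∧ Exchangeable e x r g ω := fun ω g hg =>
    ⟨Finset.mem_toList.1 (List.mem_of_find?_eq_some hg), (hp ω g).1 (List.find?_some hg)⟩
  refine ⟨f, hfm, fun ω g hg => ?_, fun A hA => ?_⟩
  · obtain ⟨h1, -, h3⟩ := hfs ω g hg
    have h1 : g ∈ annulus G x r := by simpa [hK] using h1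
    exact ⟨h3.2.1, fun v hv => ⟨(h3.2.2 v hv).mono (localGraph_le _ _ _), (h1 v hv).1⟩⟩
  · have hBm : ∀ g, MeasurableSet (A ∩ {ω | f ω = some g}) := fun g =>
      hA.measurable.inter (hfm (t := {some g}) trivial)
    have hD : (P : Measure (Config G)) A ≤ μ A := by
      rw [Measure.restrict_apply hA.measurable]
      refine measure_mono_ae ?_
      filter_upwards [hA.separates] with ω h1 h2
      exact ⟨h2, fun h3 => h1 h2 (h3.mono (localGraph_le _ _ _))⟩
    -- The measure `ρ g` is carried by exchangeable configurations, and on `H g` it dominates `μ` up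
    -- to a constant.
    have hnull : ∀ g, μ (H g \ {ω | Exchangeable e x r g ω}) = 0 := by
      intro g
      have hm : MeasurableSet (H g \ {ω | Exchangeable e x r g ω}) := MeasurableSet.diff (hHm g) (hXm g)
      refine le_antisymm ((hH g _ hm Set.sdiff_subset).trans_eq ?_) zero_le
      rw [exchangeMeasure_apply P e x r g hm]
      have : insDel g (some e) ⁻¹' (H g \ {ω | Exchangeable e x r g ω}) ∩ exchangeDomain e x r g = ∅ := by
        ext ω
        simp only [Set.mem_inter_iff, Set.mem_preimage, Set.mem_empty_iff_false, iff_false]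
        exact fun h => h.1.2 h.2.2
      rw [this, measure_empty, mul_zero]
    have hcover : A ⊆ (⋃ g ∈ K, A ∩ {ω | f ω = some g}) ∪
        ((⋂ g ∈ K, (H g)ᶜ) ∪ ⋃ g ∈ K, H g \ {ω | Exchangeable e x r g ω}) := by
      intro ω hω
      rcases hf : f ω with _ | g
      · right
        by_cases hc : ∃ g ∈ K, ω ∈ H g
        · obtain ⟨g, hg, hgH⟩ := hc
          have := List.find?_eq_none.1 hf g (Finset.mem_toList.2 hg)
          rw [hp] at this
          exact Or.inr (Set.mem_biUnion hg ⟨hgH, fun h => this ⟨hgH, h⟩⟩)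
        · left
          simp only [Set.mem_iInter, Set.mem_compl_iff]
          exact fun g hg hgH => hc ⟨g, hg, hgH⟩
      · exact Or.inl (Set.mem_biUnion (hfs ω g hf).1 ⟨hω, hf⟩)
    have hpiece : ∀ g ∈ K, μ (A ∩ {ω | f ω = some g}) ≤
        (2 * K.card : ℕ) * (P : Measure (Config G)) (insDelEvent e f A) := by
      intro g _
      refine (hH g _ (hBm g) fun ω hω => (hfs ω g hω.2).2.1).trans ?_
      rw [exchangeMeasure_apply P e x r g (hBm g)]
      gcongr
      -- Here `ω` is a configuration after the exchange: undoing it lands in `A` where `f = g`, and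
      -- redoing it shows that `ω` lies in the image of `A`.
      rintro ω ⟨⟨h1, h2⟩, h3, -⟩
      refine ⟨_, h1, ?_⟩
      change insDel e (f _) _ = ω
      rw [h2, insDel_insDel h3.2 h3.1]
    calc (P : Measure (Config G)) A ≤ μ A := hD
      _ ≤ μ (⋃ g ∈ K, A ∩ {ω | f ω = some g}) + (μ (⋂ g ∈ K, (H g)ᶜ) +
          μ (⋃ g ∈ K, H g \ {ω | Exchangeable e x r g ω})) :=
        (measure_mono hcover).trans ((measure_union_le _ _).trans
          (add_le_add_right (measure_union_le _ _) _))
      _ = μ (⋃ g ∈ K, A ∩ {ω | f ω = some g}) := by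
        have h0 : μ (⋃ g ∈ K, H g \ {ω | Exchangeable e x r g ω}) = 0 :=
          (measure_biUnion_null_iff K.countable_toSet).2 fun g _ => hnull g
        rw [hH0, h0, add_zero, add_zero]
      _ ≤ ∑ g ∈ K, μ (A ∩ {ω | f ω = some g}) := measure_biUnion_finset_le _ _
      -- One factor `K.card` comes from the Hahn decompositions, the other from this sum over the
      -- values of `f`.
      _ ≤ ∑ g ∈ K, (2 * K.card : ℕ) * (P : Measure (Config G)) (insDelEvent e f A) :=
        Finset.sum_le_sum hpiece
      _ = _ := by
        rw [Finset.sum_const, nsmul_eq_mul, hKcard, ← mul_assoc]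
        congr 1
        push_cast
        ring

/-- The added 1 in `2 * N ^ 2 + 1` makes the inequality strict, since the image of `A` has positive
probability, and keeps the constant positive when `N = 0`. -/
theorem exists_isSelection {trees : Finset V → Set (Config G)} (ht : IsTreeFamily G trees)
    (hG : G.Connected) [G.LocallyFinite] {P : ProbabilityMeasure (Config G)}
    (hP : IsUniformLimit G trees P) {x y : V} (h : G.Adj x y) (r : ℕ) {N : ℕ}
    (hN : (annulus G x r).ncard ≤ N) :
    ∃ f : Config G → Option G.edgeSet, IsSelection P h r f ∧
      ∀ A, IsSeparatingEvent P x y A →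
        ((2 * N ^ 2 + 1 : ℕ) : ℝ≥0)⁻¹ * P A < P (insDelEvent ⟨s(x, y), h⟩ f A) := by
  obtain ⟨f, hm, hloc, hf⟩ := exists_selection ht hG hP h r
  have key : ∀ A, IsSeparatingEvent P x y A →
      ((2 * N ^ 2 + 1 : ℕ) : ℝ≥0)⁻¹ * P A < P (insDelEvent ⟨s(x, y), h⟩ f A) := by
    intro A hA
    have h1 : P A ≤ (2 * N ^ 2 : ℕ) * P (insDelEvent ⟨s(x, y), h⟩ f A) := by
      have h2 := hf A hA
      rw [← ProbabilityMeasure.ennreal_coeFn_eq_coeFn_toMeasure,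
        ← ProbabilityMeasure.ennreal_coeFn_eq_coeFn_toMeasure] at h2
      have h3 : P A ≤ (2 * (annulus G x r).ncard ^ 2 : ℕ) *
          P (insDelEvent ⟨s(x, y), h⟩ f A) := by exact_mod_cast h2
      refine h3.trans ?_
      gcongr
    have hpos : 0 < P (insDelEvent ⟨s(x, y), h⟩ f A) := by
      rw [pos_iff_ne_zero]
      intro h0
      rw [h0, mul_zero] at h1
      exact absurd hA.pos (not_lt.2 h1)
    rw [inv_mul_lt_iff₀ (by positivity)]
    refine h1.trans_lt ?_
    gcongr
    omega
  refine ⟨f, ⟨hm, ae_of_all _ fun ω _ g hg => hloc ω g hg, fun A hA => ?_⟩, key⟩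
  exact zero_le.trans_lt (key A hA)

theorem isWIT_of_isUniformLimit {trees : Finset V → Set (Config G)} (ht : IsTreeFamily G trees)
    (hG : G.Connected) [G.LocallyFinite] {P : ProbabilityMeasure (Config G)}
    (hP : IsUniformLimit G trees P) : IsWIT P where
  forest := ae_isAcyclic ht hP
  tolerant _ _ h r := (exists_isSelection ht hG hP h r le_rfl).imp fun _ hf => hf.1

end USF

theorem lemma1p4 {V : Type*} [Infinite V] [Countable V] (G : SimpleGraph V) [G.LocallyFinite]
    (hconn : G.Connected) (hqt : USF.IsQuasitransitive G) :
    (∀ P : ProbabilityMeasure (USF.Config G), USF.IsFUSF G P → USF.IsWIT P) ∧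
    (∀ P : ProbabilityMeasure (USF.Config G), USF.IsWUSF G P → USF.IsWIT P) ∧
    ∃ δ : ℕ → ℝ≥0, (∀ r, 0 < δ r) ∧
      ∀ P : ProbabilityMeasure (USF.Config G), (USF.IsFUSF G P ∨ USF.IsWUSF G P) →
        ∀ (x y : V) (h : G.Adj x y) (r : ℕ),
          ∃ f : USF.Config G → Option G.edgeSet, USF.IsSelection P h r f ∧
            ∀ A : Set (USF.Config G), USF.IsSeparatingEvent P x y A →
              δ r * P A < P (USF.insDelEvent ⟨s(x, y), h⟩ f A) := by
  have hF := USF.isTreeFamily_freeTrees hconn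
  have hW := USF.isTreeFamily_wiredTrees hconn
  choose N hN using USF.exists_ncard_annulus_le hconn hqt
  refine ⟨fun P hP => USF.isWIT_of_isUniformLimit hF hconn hP,
    fun P hP => USF.isWIT_of_isUniformLimit hW hconn hP,
    fun r => ((2 * N r ^ 2 + 1 : ℕ) : ℝ≥0)⁻¹, fun r => by positivity, ?_⟩
  rintro P (hP | hP) x y h r
  · exact USF.exists_isSelection hF hconn hP h r (hN r x)
  · exact USF.exists_isSelection hW hconn hP h r (hN r x)
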